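/- Let $\mathbb K$ be $\mathbb R$ or $\mathbb C$. A pointed metric space is a metric space with a distinguished point, denoted $0$. For pointed metric spaces $X,Y$, let $\mathrm{Lip}_0(X,Y)$ be the set of Lipschitz maps $f\colon X\to Y$ with $f(0)=0$, and let $\mathrm{Lip}(f)$ be the least Lipschitz constant of $f$; a Banach space over $\mathbb K$ is a pointed metric space with base point its zero vector. A *generic Lipschitz operator Banach ideal* $A$ assigns to each pointed metric space $X$ and each Banach space $E$ over $\mathbb K$ a linear subspace $A(X,E)$ of $\mathrm{Lip}_0(X,E)$ with a norm $\|\cdot\|_A$ such that, for all pointed metric spaces $X,Z$ and Banach spaces $E,F$: 1. if $g\in \mathrm{Lip}_0(X,\mathbb K)$ and $e\in E$, then the map $g\cdot e\colon x\mapsto g(x)e$ belongs to $A(X,E)$ and $\|g\cdot e\|_A\le \mathrm{Lip}(g)\|e\|$; 2. $\mathrm{Lip}(f)\le\|f\|_A$ for all $f\in A(X,E)$; 3. $(A(X,E),\|\cdot\|_A)$ is a Banach space; 4. if $f\in A(X,E)$, $h\in\mathrm{Lip}_0(Z,X)$ and $S\colon E\to F$ is a bounded linear operator, then $S\circ f\circ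 h\in A(Z,F)$ and $\|S\circ f\circ h\|_A\le\|S\|\,\|f\|_A\,\mathrm{Lip}(h)$. For $f\in\mathrm{Lip}_0(X,E)$ put $$\|f\|_{A^{\max}}=\sup_{Y,L}\ \|Q_L\circ f\circ I_Y\|_A ,$$ where $Y$ runs over the finite subsets of $X$ that contain $0$, with inclusion $I_Y\colon Y\to X$, and $L$ runs over the closed finite-codimensional linear subspaces of $E$, with quotient map $Q_L\colon E\to E/L$. (Each $Q_L\circ f\circ I_Y$ lies in $A(Y,E/L)$, as a finite sum of maps $g\cdot e$.) The ideal $A$ is *maximal* if for all $X$ and $E$ one has $A(X,E)=\{f\in\mathrm{Lip}_0(X,E):\|f\|_{A^{\max}}<\infty\}$, and $\|f\|_A=\|f\|_{A^{\max}}$ for every $f\in A(X,E)$. **Statement.** Let $A$ be a maximal generic Lipschitz operator Banach ideal. Then $A$ is regular: for every pointed metric space $X$, every Banach space $E$ and every $f\in\mathrm{Lip}_0(X,E)$, with $\kappa_E\colon E\to E^{**}$ the canonical embedding, $$f\in A(X,E)\iff \kappa_E\circ f\in A(X,E^{**}),$$ and in this case $\|f\|_A=\|\kappa_E\circ f\|_A$.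 -/

import Mathlib

open scoped ENNReal NNReal

universe u v

/-! A pointed metric space is a type with instances `[MetricSpace X] [Zero X]`: the base point
is written `0` and need have nothing to do with an algebraic structure.  A normed space is a
pointed metric space through its norm and its zero vector. -/

/-- `f ∈ Lip₀(X, Y)`: `f` is Lipschitz and preserves the base point. -/
def IsLip0 {X : Type*} {Y : Type*} [MetricSpace X] [Zero X] [MetricSpace Y] [Zero Y]
    (f : X → Y) : Prop :=
  f 0 = 0 ∧ ∃ C : ℝ≥0, LipschitzWith C f

/-- `Lip(f)`, the least Lipschitz constant of a Lipschitz map `f`. -/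
noncomputable def lipConst {X : Type*} {Y : Type*} [MetricSpace X] [MetricSpace Y]
    (f : X → Y) : ℝ :=
  sInf {C : ℝ | 0 ≤ C ∧ ∀ x y, dist (f x) (f y) ≤ C * dist x y}

/-- A generic Lipschitz operator Banach ideal over `𝕜`: for each pointed metric space `X` and
each Banach space `E`, a linear subspace `space X E` of `Lip₀(X, E)` with a norm `nrm X E`,
subject to the laws below. -/
structure GenericLipIdeal (𝕜 : Type) [RCLike 𝕜] where
  /-- the linear space `A(X, E)` -/
  space : ∀ (X : Type u) [MetricSpace X] [Zero X]
    (E : Type v) [NormedAddCommGroup E] [NormedSpace 𝕜 E] [CompleteSpace E],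
    Submodule 𝕜 (X → E)
  /-- the norm `‖·‖_A` on `A(X, E)` -/
  nrm : ∀ (X : Type u) [MetricSpace X] [Zero X]
    (E : Type v) [NormedAddCommGroup E] [NormedSpace 𝕜 E] [CompleteSpace E],
    Seminorm 𝕜 (space X E)
  /-- `A(X, E) ⊆ Lip₀(X, E)` -/
  isLip0 : ∀ (X : Type u) [MetricSpace X] [Zero X]
    (E : Type v) [NormedAddCommGroup E] [NormedSpace 𝕜 E] [CompleteSpace E],
    ∀ f ∈ space X E, IsLip0 f
  /-- `‖·‖_A` is a norm -/
  eq_zero_of_nrm : ∀ (X : Type u) [MetricSpace X] [Zero X]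
    (E : Type v) [NormedAddCommGroup E] [NormedSpace 𝕜 E] [CompleteSpace E]
    (f : space X E), nrm X E f = 0 → f = 0
  /-- rank-one operators `g · e` belong to `A(X, E)`, with `‖g · e‖_A ≤ Lip(g) ‖e‖` -/
  rankOne : ∀ (X : Type u) [MetricSpace X] [Zero X]
    (E : Type v) [NormedAddCommGroup E] [NormedSpace 𝕜 E] [CompleteSpace E]
    (g : X → 𝕜) (e : E), IsLip0 g →
    ∃ h : (fun x => g x • e) ∈ space X E, nrm X E ⟨fun x => g x • e, h⟩ ≤ lipConst g * ‖e‖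
  /-- `Lip ≤ ‖·‖_A` -/
  lipConst_le : ∀ (X : Type u) [MetricSpace X] [Zero X]
    (E : Type v) [NormedAddCommGroup E] [NormedSpace 𝕜 E] [CompleteSpace E]
    (f : space X E), lipConst (f : X → E) ≤ nrm X E f
  /-- `(A(X, E), ‖·‖_A)` is complete: every Cauchy sequence converges -/
  complete : ∀ (X : Type u) [MetricSpace X] [Zero X]
    (E : Type v) [NormedAddCommGroup E] [NormedSpace 𝕜 E] [CompleteSpace E]
    (s : ℕ → space X E),
    (∀ ε : ℝ, 0 < ε → ∃ N, ∀ m ≥ N, ∀ n ≥ N, nrm X E (s m - s n) < ε) →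
    ∃ f : space X E, ∀ ε : ℝ, 0 < ε → ∃ N, ∀ n ≥ N, nrm X E (s n - f) < ε
  /-- the ideal property: `S f h ∈ A(Z, F)` and `‖S f h‖_A ≤ ‖S‖ ‖f‖_A Lip(h)` -/
  comp : ∀ (Z : Type u) [MetricSpace Z] [Zero Z] (X : Type u) [MetricSpace X] [Zero X]
    (E : Type v) [NormedAddCommGroup E] [NormedSpace 𝕜 E] [CompleteSpace E]
    (F : Type v) [NormedAddCommGroup F] [NormedSpace 𝕜 F] [CompleteSpace F]
    (f : space X E) (h : Z → X) (S : E →L[𝕜] F), IsLip0 h →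
    ∃ hm : (fun z => S ((f : X → E) (h z))) ∈ space Z F,
      nrm Z F ⟨fun z => S ((f : X → E) (h z)), hm⟩ ≤ ‖S‖ * nrm X E f * lipConst h

/-- `MFIN(X)`: the finite subsets of `X` that contain the base point. -/
structure MFIN (X : Type u) [Zero X] where
  points : Set X
  finite : points.Finite
  zero_mem : 0 ∈ points

/-- A set in `MFIN(X)` is a pointed metric space with the base point of `X`. -/
instance {X : Type u} [Zero X] (Y : MFIN X) : Zero Y.points := ⟨⟨0, Y.zero_mem⟩⟩

/-- `COFIN(E)`: the closed finite-codimensional subspaces of `E`. -/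
structure COFIN (𝕜 : Type) [RCLike 𝕜] (E : Type v) [NormedAddCommGroup E]
    [NormedSpace 𝕜 E] where
  sub : Submodule 𝕜 E
  closed : IsClosed (sub : Set E)
  finite : FiniteDimensional 𝕜 (E ⧸ sub)

instance {𝕜 : Type} [RCLike 𝕜] {E : Type v} [NormedAddCommGroup E] [NormedSpace 𝕜 E]
    (L : COFIN 𝕜 E) : IsClosed (L.sub : Set E) := L.closed

namespace GenericLipIdeal

variable {𝕜 : Type} [RCLike 𝕜]

open Classical in
/-- `‖f‖_A ∈ [0, ∞]`, with the convention that `‖f‖_A = ∞` if `f ∉ A(X, E)`. -/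
noncomputable def extNorm (A : GenericLipIdeal.{u, v} 𝕜) {X : Type u} [MetricSpace X] [Zero X]
    {E : Type v} [NormedAddCommGroup E] [NormedSpace 𝕜 E] [CompleteSpace E] (f : X → E) : ℝ≥0∞ :=
  if h : f ∈ A.space X E then ENNReal.ofReal (A.nrm X E ⟨f, h⟩) else ∞

/-- `‖f‖_{A^max}`, the supremum of `‖Q_L ∘ f ∘ I_Y‖_A` over `Y ∈ MFIN(X)` and `L ∈ COFIN(E)`,
where `I_Y : Y → X` is the inclusion and `Q_L : E → E ⧸ L` the quotient map. -/
noncomputable def maxNorm (A : GenericLipIdeal.{u, v} 𝕜) {X : Type u} [MetricSpace X] [Zero X]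
    {E : Type v} [NormedAddCommGroup E] [NormedSpace 𝕜 E] [CompleteSpace E] (f : X → E) : ℝ≥0∞ :=
  ⨆ (Y : MFIN X) (L : COFIN 𝕜 E),
    A.extNorm (X := Y.points) (E := E ⧸ L.sub) (fun y => L.sub.mkQ (f y))

/-- `A` is maximal: `(A, ‖·‖_A) = (A^max, ‖·‖_{A^max})`, where `A^max(X, E)` consists of the
`f ∈ Lip₀(X, E)` with `‖f‖_{A^max} < ∞`. -/
def IsMaximal (A : GenericLipIdeal.{u, v} 𝕜) : Prop :=
  ∀ (X : Type u) [MetricSpace X] [Zero X]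
    (E : Type v) [NormedAddCommGroup E] [NormedSpace 𝕜 E] [CompleteSpace E] (f : X → E),
    (f ∈ A.space X E ↔ IsLip0 f ∧ A.maxNorm f < ∞) ∧
    ∀ hf : f ∈ A.space X E, ENNReal.ofReal (A.nrm X E ⟨f, hf⟩) = A.maxNorm f

end GenericLipIdeal

/-! Since `κ_E` is a contraction, the ideal property gives `‖κ_E ∘ f‖_A ≤ ‖f‖_A`. Conversely, each
`E/L` is finite-dimensional, hence its own bidual, so `Q_L**` yields a contraction `S : E** → E/L`
with `S ∘ κ_E = Q_L` (`exists_extend_inclusionInDoubleDual`). Thus `Q_L ∘ f ∘ I_Y = S ∘ (κ_E ∘ f) ∘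
I_Y` has norm at most `‖κ_E ∘ f‖_A`. The supremum over `Y` and `L` bounds `‖f‖_{A^max}`, and
maximality turns this into a statement about `A`. -/

theorem lipConst_le_one {X Y : Type*} [MetricSpace X] [MetricSpace Y] {f : X → Y}
    (hf : ∀ x y, dist (f x) (f y) ≤ dist x y) : lipConst f ≤ 1 :=
  csInf_le ⟨0, fun _ hC => hC.1⟩ ⟨zero_le_one, fun x y => by simpa using hf x y⟩

theorem lipConst_nonneg {X Y : Type*} [MetricSpace X] [MetricSpace Y] (f : X → Y) :
    0 ≤ lipConst f :=
  Real.sInf_nonneg fun _ hC => hC.1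

/-- The canonical embedding of a finite-dimensional normed space into its bidual has a
contractive left inverse. -/
theorem exists_leftInverse_inclusionInDoubleDual (𝕜 : Type*) [RCLike 𝕜] (G : Type*)
    [NormedAddCommGroup G] [NormedSpace 𝕜 G] [FiniteDimensional 𝕜 G] :
    ∃ R : StrongDual 𝕜 (StrongDual 𝕜 G) →L[𝕜] G,
      (∀ φ, ‖R φ‖ ≤ ‖φ‖) ∧ ∀ x, R (NormedSpace.inclusionInDoubleDual 𝕜 G x) = x := by
  -- Equal finite dimensions make the isometric embedding into the bidual surjective; its inverse is
  -- `R`.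
  have hdim : Module.finrank 𝕜 G = Module.finrank 𝕜 (StrongDual 𝕜 (StrongDual 𝕜 G)) :=
    calc Module.finrank 𝕜 G = Module.finrank 𝕜 (Module.Dual 𝕜 G) :=
          Subspace.dual_finrank_eq.symm
      _ = Module.finrank 𝕜 (StrongDual 𝕜 G) := LinearMap.toContinuousLinearMap.finrank_eq
      _ = Module.finrank 𝕜 (Module.Dual 𝕜 (StrongDual 𝕜 G)) := Subspace.dual_finrank_eq.symm
      _ = Module.finrank 𝕜 (StrongDual 𝕜 (StrongDual 𝕜 G)) :=
          LinearMap.toContinuousLinearMap.finrank_eq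
  let e := (NormedSpace.inclusionInDoubleDualLi 𝕜 (E := G)).toLinearIsometryEquiv hdim
  exact ⟨e.symm.toContinuousLinearEquiv, fun φ => (e.symm.norm_map φ).le,
    fun x => e.symm_apply_apply x⟩

/-- A contraction into a finite-dimensional space extends along the canonical embedding of its
domain into the bidual to a contraction. -/
theorem exists_extend_inclusionInDoubleDual {𝕜 : Type*} [RCLike 𝕜] {E G : Type*}
    [NormedAddCommGroup E] [NormedSpace 𝕜 E] [NormedAddCommGroup G] [NormedSpace 𝕜 G]
    [FiniteDimensional 𝕜 G] (Q : E →L[𝕜] G) (hQ : ‖Q‖ ≤ 1) :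
    ∃ S : StrongDual 𝕜 (StrongDual 𝕜 E) →L[𝕜] G,
      (∀ φ, ‖S φ‖ ≤ ‖φ‖) ∧ ∀ x, S (NormedSpace.inclusionInDoubleDual 𝕜 E x) = Q x := by
  obtain ⟨R, hR, hRx⟩ := exists_leftInverse_inclusionInDoubleDual 𝕜 G
  let T : StrongDual 𝕜 G →L[𝕜] StrongDual 𝕜 E := ContinuousLinearMap.precomp 𝕜 Q
  have hT (ψ : StrongDual 𝕜 G) : ‖T ψ‖ ≤ ‖ψ‖ :=
    (ψ.opNorm_comp_le Q).trans (mul_le_of_le_one_right (norm_nonneg _) hQ)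
  -- `T` is `Q*` and `U` is `Q**`. Naturality, `Q** ∘ κ_E = κ_G ∘ Q`, holds by definition, so `R ∘
  -- U` extends `Q`.
  let U : StrongDual 𝕜 (StrongDual 𝕜 E) →L[𝕜] StrongDual 𝕜 (StrongDual 𝕜 G) :=
    ContinuousLinearMap.precomp 𝕜 T
  have hU (φ : StrongDual 𝕜 (StrongDual 𝕜 E)) : ‖U φ‖ ≤ ‖φ‖ :=
    ContinuousLinearMap.opNorm_le_bound _ (norm_nonneg φ) fun ψ =>
      (φ.le_opNorm (T ψ)).trans (mul_le_mul_of_nonneg_left (hT ψ) (norm_nonneg φ))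
  exact ⟨R.comp U, fun φ => (hR (U φ)).trans (hU φ), fun x => hRx (Q x)⟩

namespace GenericLipIdeal

variable {𝕜 : Type} [RCLike 𝕜]

theorem nrm_nonneg (A : GenericLipIdeal.{u, v} 𝕜) {X : Type u} [MetricSpace X] [Zero X]
    {E : Type v} [NormedAddCommGroup E] [NormedSpace 𝕜 E] [CompleteSpace E]
    (f : A.space X E) : 0 ≤ A.nrm X E f :=
  apply_nonneg _ _

/-- Composition with contractions on both sides does not increase the ideal norm. -/
theorem nrm_comp_le_of_contractive (A : GenericLipIdeal.{u, v} 𝕜)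
    {Z : Type u} [MetricSpace Z] [Zero Z] {X : Type u} [MetricSpace X] [Zero X]
    {E : Type v} [NormedAddCommGroup E] [NormedSpace 𝕜 E] [CompleteSpace E]
    {F : Type v} [NormedAddCommGroup F] [NormedSpace 𝕜 F] [CompleteSpace F]
    {f : X → E} (hf : f ∈ A.space X E) {h : Z → X} (h0 : h 0 = 0)
    (hd : ∀ x y, dist (h x) (h y) ≤ dist x y) {S : E → F}
    (hadd : ∀ d e, S (d + e) = S d + S e) (hsmul : ∀ (c : 𝕜) e, S (c • e) = c • S e)
    (hS : ∀ e, ‖S e‖ ≤ ‖e‖) :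
    ∃ hm : (fun z => S (f (h z))) ∈ A.space Z F,
      A.nrm Z F ⟨fun z => S (f (h z)), hm⟩ ≤ A.nrm X E ⟨f, hf⟩ := by
  let T : E →L[𝕜] F := LinearMap.mkContinuous { toFun := S, map_add' := hadd, map_smul' := hsmul }
    1 fun e => by simpa using hS e
  obtain ⟨hm, hle⟩ := A.comp Z X E F ⟨f, hf⟩ h T
    ⟨h0, 1, LipschitzWith.of_dist_le_mul fun x y => by simpa using hd x y⟩
  refine ⟨hm, hle.trans ?_⟩
  have hT : ‖T‖ ≤ 1 := LinearMap.mkContinuous_norm_le _ zero_le_one _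
  have hn : 0 ≤ A.nrm X E ⟨f, hf⟩ := A.nrm_nonneg _
  calc ‖T‖ * A.nrm X E ⟨f, hf⟩ * lipConst h ≤ 1 * A.nrm X E ⟨f, hf⟩ * 1 := by
        gcongr
        · exact lipConst_nonneg h
        · exact lipConst_le_one hd
    _ = A.nrm X E ⟨f, hf⟩ := by ring

/-- The maximal norm of `f` is at most the norm of `f` followed by the canonical embedding into
the bidual. -/
theorem maxNorm_le_nrm_inclusionInDoubleDual (A : GenericLipIdeal.{u, v} 𝕜)
    {X : Type u} [MetricSpace X] [Zero X]
    {E : Type v} [NormedAddCommGroup E] [NormedSpace 𝕜 E] [CompleteSpace E] {f : X → E}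
    (h : (fun x => NormedSpace.inclusionInDoubleDual 𝕜 E (f x)) ∈
      A.space X (StrongDual 𝕜 (StrongDual 𝕜 E))) :
    A.maxNorm f ≤ ENNReal.ofReal (A.nrm X (StrongDual 𝕜 (StrongDual 𝕜 E))
      ⟨fun x => NormedSpace.inclusionInDoubleDual 𝕜 E (f x), h⟩) := by
  refine iSup_le fun Y => iSup_le fun L => ?_
  have := L.finite
  let Q : E →L[𝕜] E ⧸ L.sub := L.sub.mkQL
  have hQ : ‖Q‖ ≤ 1 := Q.opNorm_le_bound zero_le_one fun x => by
    rw [one_mul]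
    exact Submodule.Quotient.norm_mk_le L.sub x
  obtain ⟨S, hS, hSx⟩ := exists_extend_inclusionInDoubleDual Q hQ
  obtain ⟨hm, hle⟩ := A.nrm_comp_le_of_contractive h (Z := Y.points) (h := Subtype.val) rfl
    (fun _ _ => le_rfl)
    (S := S) (map_add S) (map_smul S) hS
  -- The factorization through `κ_E ∘ f` also supplies membership in `A`, without which `extNorm`
  -- would be `∞`.
  have heq : (fun y : Y.points => L.sub.mkQ (f y)) =
      fun y : Y.points => S (NormedSpace.inclusionInDoubleDual 𝕜 E (f y)) :=
    funext fun y => (hSx (f y)).symm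
  rw [heq, extNorm, dif_pos hm]
  exact ENNReal.ofReal_le_ofReal hle

end GenericLipIdeal

theorem mainTheorem11 {𝕜 : Type} [RCLike 𝕜] (A : GenericLipIdeal.{u, v} 𝕜) (hA : A.IsMaximal)
    (X : Type u) [MetricSpace X] [Zero X]
    (E : Type v) [NormedAddCommGroup E] [NormedSpace 𝕜 E] [CompleteSpace E]
    (f : X → E) (hf : IsLip0 f) :
    (f ∈ A.space X E ↔
      (fun x => NormedSpace.inclusionInDoubleDual 𝕜 E (f x)) ∈
        A.space X (StrongDual 𝕜 (StrongDual 𝕜 E))) ∧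
    ∀ (h₁ : f ∈ A.space X E)
      (h₂ : (fun x => NormedSpace.inclusionInDoubleDual 𝕜 E (f x)) ∈
        A.space X (StrongDual 𝕜 (StrongDual 𝕜 E))),
      A.nrm X E ⟨f, h₁⟩ =
        A.nrm X (StrongDual 𝕜 (StrongDual 𝕜 E))
          ⟨fun x => NormedSpace.inclusionInDoubleDual 𝕜 E (f x), h₂⟩ := by
  have hmax := A.maxNorm_le_nrm_inclusionInDoubleDual (f := f)
  have forward (h : f ∈ A.space X E) :=
    A.nrm_comp_le_of_contractive h (Z := X) (h := id) rfl (fun _ _ => le_rfl)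
      (F := StrongDual 𝕜 (StrongDual 𝕜 E)) (S := NormedSpace.inclusionInDoubleDual 𝕜 E)
      (fun _ _ => map_add _ _ _) (fun _ _ => map_smul _ _ _)
      (NormedSpace.double_dual_bound 𝕜 E)
  refine ⟨⟨fun h => (forward h).1, fun h => (hA X E f).1.2
    ⟨hf, (hmax h).trans_lt ENNReal.ofReal_lt_top⟩⟩,
    fun h₁ h₂ => le_antisymm ?_ (forward h₁).2⟩
  -- Maximality replaces `‖f‖_A` by `‖f‖_{A^max}`, which `hmax` bounds.
  rw [← ENNReal.ofReal_le_ofReal_iff (A.nrm_nonneg _), (hA X E f).2 h₁]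
  exact hmax h₂
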